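/- Let $m\ge 1$. One evader (player $1$) and $m$ pursuers (players $2,\dots,m+1$) move on a line. Player $k$ has state $x^k=(x^k_1,x^k_2)\in\mathbb{R}^2$ (position and velocity), and for $i=2,\dots,m+1$ $$\dot x^1_1=x^1_2,\quad \dot x^1_2=-d_1(x^1_2)+a,\qquad \dot x^i_1=x^i_2,\quad \dot x^i_2=-d_i(x^i_2)+b_{i-1},$$ where, for constants $k_d,c_d,\alpha,\beta_1,\dots,\beta_m>0$, the functions $d_k:\mathbb{R}\to\mathbb{R}$ satisfy $|d_k(y)-d_k(y')|\le k_d|y-y'|$ and $d_k(y)\le c_d$ for all $y,y'\in\mathbb{R}$ and $k=1,\dots,m+1$, and where $\beta_i>\alpha+2c_d$ for $i=1,\dots,m$. Let $\mathcal A$ be the set of measurable $a:[0,\infty)\to\mathbb{R}$ with $|a(t)|\le\alpha$ a.e., and $\mathcal B$ the set of measurable $b:[0,\infty)\to\mathbb{R}^m$ with $|b_i(t)|\le\beta_i$ a.e. for every $i$. Let $\Phi$ be the set of maps $\phi:\mathcal B\to\mathcal A$ that are non-anticipative: for every $t'\ge0$, if $b=b'$ a.e. on $[0,t']$, then $\phi(b)=\phi(b')$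 a.e. on $[0,t']$. For $i=2,\dots,m+1$ put $$\mathcal T_i=\{x=(x^1,\dots,x^{m+1})\in(\mathbb{R}^2)^{m+1} : x^i_1\ge x^1_1\},\qquad \mathcal T=\bigcup_{i=2}^{m+1}\mathcal T_i,$$ and let $u_i$ be the upper value of the game with target $\mathcal T_i$, that is $$u_i(x)=\sup_{\phi\in\Phi}\ \inf_{b\in\mathcal B}\ \tau_i(x,\phi(b),b)\in[0,\infty],$$ where $\tau_i(x,a,b)=\inf\{t\ge0 : x(t)\in\mathcal T_i\}$ (with $\inf\emptyset=\infty$) is the first entry time into $\mathcal T_i$ of the trajectory starting at $x$ under the controls $a,b$. Consider the Hamilton-Jacobi-Isaacs equation $F(x,Du(x))=0$ with $$F(x,p)=\sum_{k=1}^{m+1}\bigl(-p^k_1x^k_2+p^k_2\,d_k(x^k_2)\bigr)-\alpha|p^1_2|+\sum_{i=2}^{m+1}\beta_{i-1}|p^i_2|-1 .$$ A continuous function $u:\Omega\to\mathbb{R}$ on an open set $\Omega$ is a continuous viscosity solution if $F(x,p)\le0$ for all $x\in\Omega$ and $p\in D^+u(x)$, and $F(x,p)\ge0$ for all $x\in\Omega$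 and $p\in D^-u(x)$. Here $D^+u(x)$ and $D^-u(x)$ are the Fréchet super- and subdifferentials, i.e. the sets of $p$ with $\limsup_{y\to x}\frac{u(y)-u(x)-p\cdot(y-x)}{|y-x|}\le0$ and $\liminf_{y\to x}\frac{u(y)-u(x)-p\cdot(y-x)}{|y-x|}\ge0$, respectively. Assume: (a) for $i=2,\dots,m+1$, $u_i$ is real-valued on $(\mathbb{R}^2)^{m+1}\setminus\mathcal T_i$ and is a continuous viscosity solution of $F(x,Du)=0$ there; (b) for all $i\ne j$ in $\{2,\dots,m+1\}$ and every $x\in(\mathbb{R}^2)^{m+1}\setminus\mathcal T$ with $u_i(x)=u_j(x)$, both $u_i$ and $u_j$ are Lipschitz continuous on a neighbourhood of $x$. Then $\bar u(x)=\min\{u_2(x),\dots,u_{m+1}(x)\}$ is a continuous viscosity solution of $F(x,Du)=0$ on $(\mathbb{R}^2)^{m+1}\setminus\mathcal T$. -/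

import Mathlib

open Set Filter Topology MeasureTheory
open scoped ENNReal NNReal RealInnerProductSpace

noncomputable section

/-! ### Viscosity solutions of first order equations `F (x, u(x), Du(x)) = 0` -/

namespace Viscosity

variable {E : Type*} [NormedAddCommGroup E] [InnerProductSpace ℝ E]

/-- The Fréchet superdifferential `D⁺u(x)`: the vectors `p` with
`limsup_{y → x} (u y - u x - p · (y - x)) / |y - x| ≤ 0`, the limsup being written out. -/
def superdifferential (u : E → ℝ) (x : E) : Set E :=
  {p | ∀ ε : ℝ, 0 < ε → ∀ᶠ y in 𝓝 x, u y - u x - ⟪p, y - x⟫ ≤ ε * ‖y - x‖}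

/-- The Fréchet subdifferential `D⁻u(x)`: the vectors `p` with
`liminf_{y → x} (u y - u x - p · (y - x)) / |y - x| ≥ 0`, the liminf being written out. -/
def subdifferential (u : E → ℝ) (x : E) : Set E :=
  {p | ∀ ε : ℝ, 0 < ε → ∀ᶠ y in 𝓝 x, -(ε * ‖y - x‖) ≤ u y - u x - ⟪p, y - x⟫}

/-- `u` is a continuous viscosity subsolution of `F(x, u, Du) = 0` on the open set `Ω`.
Only the restriction of `u` to `Ω` matters. -/
def IsSubsolution (F : E → ℝ → E → ℝ) (Ω : Set E) (u : E → ℝ) : Prop :=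
  ContinuousOn u Ω ∧ ∀ x ∈ Ω, ∀ p ∈ superdifferential u x, F x (u x) p ≤ 0

/-- `u` is a continuous viscosity supersolution of `F(x, u, Du) = 0` on the open set `Ω`. -/
def IsSupersolution (F : E → ℝ → E → ℝ) (Ω : Set E) (u : E → ℝ) : Prop :=
  ContinuousOn u Ω ∧ ∀ x ∈ Ω, ∀ p ∈ subdifferential u x, 0 ≤ F x (u x) p

/-- `u` is a continuous viscosity solution of `F(x, u, Du) = 0` on the open set `Ω`. -/
def IsSolution (F : E → ℝ → E → ℝ) (Ω : Set E) (u : E → ℝ) : Prop :=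
  IsSubsolution F Ω u ∧ IsSupersolution F Ω u

/-- `u` is Lipschitz continuous on some neighbourhood of `x`. -/
def LipschitzNear (u : E → ℝ) (x : E) : Prop :=
  ∃ K : ℝ≥0, ∃ U ∈ 𝓝 x, LipschitzOnWith K u U

end Viscosity

/-! ### The game with one evader and `m` pursuers -/

namespace PursuitEvasion

/-- The joint state in `(ℝ²)^{m+1}`. Player `0` is the evader and player `i.succ`, `i : Fin m`, is
the `i`-th pursuer; `x (k, 0)` is the position and `x (k, 1)` the velocity of player `k`. -/
abbrev State (m : ℕ) := EuclideanSpace ℝ (Fin (m + 1) × Fin 2)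

variable {m : ℕ}

/-- The right-hand side of the state equation: every player `k` satisfies `ẋ₁ = x₂` and
`ẋ₂ = -d_k(x₂) + (own control)`, the controls being `a` for the evader and `b i` for pursuer `i`. -/
def dynamics (d : Fin (m + 1) → ℝ → ℝ) (x : State m) (a : ℝ) (b : Fin m → ℝ) : State m :=
  WithLp.toLp 2 fun k =>
    if k.2 = 0 then x (k.1, 1)
    else -d k.1 (x (k.1, 1)) + (Fin.cons a b : Fin (m + 1) → ℝ) k.1

/-- Open loop policies of the evader: measurable, with `|a(t)| ≤ α` for a.e. `t ≥ 0`.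
(Values at negative times play no role anywhere.) -/
def EvaderControl (α : ℝ) : Type :=
  {a : ℝ → ℝ // Measurable a ∧ ∀ᵐ t ∂(volume.restrict (Ici (0 : ℝ))), |a t| ≤ α}

/-- Open loop policies of the team of pursuers: measurable, with `|b_i(t)| ≤ β_i` for every `i`
and a.e. `t ≥ 0`. -/
def PursuerControl (β : Fin m → ℝ) : Type :=
  {b : ℝ → Fin m → ℝ // Measurable b ∧
    ∀ᵐ t ∂(volume.restrict (Ici (0 : ℝ))), ∀ i, |b t i| ≤ β i}

/-- Closed loop policies of the evader: non-anticipative maps from open loop policies of the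
pursuers to open loop policies of the evader. -/
def Strategy (α : ℝ) (β : Fin m → ℝ) : Type :=
  {φ : PursuerControl β → EvaderControl α //
    ∀ T : ℝ, 0 ≤ T → ∀ b₁ b₂ : PursuerControl β,
      (∀ᵐ t ∂(volume.restrict (Icc 0 T)), b₁.1 t = b₂.1 t) →
        ∀ᵐ t ∂(volume.restrict (Icc 0 T)), (φ b₁).1 t = (φ b₂).1 t}

/-- `y` is, on `[0, ∞)`, the (absolutely continuous) solution of the state equation with initial
state `x₀` under the controls `a`, `b`, written in integrated form. For Lipschitz `d` and
admissible `a`, `b` the integrand is locally integrable, and `y` exists and is unique on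
`[0, ∞)`. -/
def IsTrajectory (d : Fin (m + 1) → ℝ → ℝ) (x₀ : State m) (a : ℝ → ℝ) (b : ℝ → Fin m → ℝ)
    (y : ℝ → State m) : Prop :=
  ContinuousOn y (Ici 0) ∧
    ∀ t : ℝ, 0 ≤ t → ∀ k, y t k = x₀ k + ∫ s in (0 : ℝ)..t, dynamics d (y s) (a s) (b s) k

/-- First time `t ≥ 0` at which `y` is in the target `T`; it is `∞` if there is no such time. -/
def entryTime (T : Set (State m)) (y : ℝ → State m) : ℝ≥0∞ :=
  ⨅ (t : ℝ≥0) (_ : y t ∈ T), (t : ℝ≥0∞)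

/-- The pay-off `∫₀^τ 1 dt = τ`, where `τ` is the first entry time into `T` of the trajectory
that starts at `x₀`. The infimum over `y` merely selects the unique trajectory. -/
def payoff (d : Fin (m + 1) → ℝ → ℝ) (T : Set (State m)) (x₀ : State m) (a : ℝ → ℝ)
    (b : ℝ → Fin m → ℝ) : ℝ≥0∞ :=
  ⨅ (y : ℝ → State m) (_ : IsTrajectory d x₀ a b y), entryTime T y

/-- The upper value `sup_φ inf_b J(x₀, φ(b), b)` of the game with target `T`, in `[0, ∞]`. -/
def upperValue (d : Fin (m + 1) → ℝ → ℝ) (α : ℝ) (β : Fin m → ℝ) (T : Set (State m))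
    (x₀ : State m) : ℝ≥0∞ :=
  ⨆ φ : Strategy α β, ⨅ b : PursuerControl β, payoff d T x₀ (φ.1 b).1 b.1

/-- The target component `𝒯_i`: pursuer `i` has overtaken the evader. -/
def target (i : Fin m) : Set (State m) :=
  {x | x (0, 0) ≤ x (i.succ, 0)}

/-- The left-hand side of the Hamilton-Jacobi-Isaacs equation. -/
def hamiltonian (d : Fin (m + 1) → ℝ → ℝ) (α : ℝ) (β : Fin m → ℝ) (x : State m) (_u : ℝ)
    (p : State m) : ℝ :=
  (∑ k : Fin (m + 1), (-(p (k, 0) * x (k, 1)) + p (k, 1) * d k (x (k, 1))))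
    - α * |p (0, 1)| + (∑ i : Fin m, β i * |p (i.succ, 1)|) - 1

end PursuitEvasion

end

/-! The supersolution half is soft: a minimum touches each active `u i` from below. For the
subsolution half, a supergradient of the minimum at a point with several active functions need not
be one of any of them, and `F` is not convex in `p` because of the term `-α|p (0, 1)|`.

The game removes this obstruction. Giving the evader a smaller initial velocity cannot hurt the
pursuers, so each `u i` is nondecreasing in that variable (`upperValue_le_upperValue`) and its
supergradients have `p (0, 1) ≥ 0`. On that half-space `F + 1` is the supremum over `b` of the
linear functions `⟪p, -dynamics d x α b⟫`. For fixed `b` the subsolution property is then a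
one-sided bound in one direction; it integrates along segments
(`sub_le_mul_of_superdifferential_inner_le`, by penalization), with the Lipschitz assumption
absorbing the change of the dynamics from point to point. Such decay rates pass to finite minima
(`inner_le_of_mem_superdifferential_iInf`), and taking the supremum over `b` recovers `F ≤ 0`. -/

namespace Viscosity

/-! ### Supergradients and directional bounds -/

variable {E : Type*} [NormedAddCommGroup E] [InnerProductSpace ℝ E]

/-- If `u` is touched from above at `z` by `w ↦ n * ‖w - a‖ ^ 2`, up to a constant, then the
gradient of this function belongs to the superdifferential. -/
lemma smul_mem_superdifferential {u : E → ℝ} {z a : E} {n : ℝ} (hn : 0 < n)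
    (h : ∀ᶠ w in 𝓝 z, u w - n * ‖w - a‖ ^ 2 ≤ u z - n * ‖z - a‖ ^ 2) :
    (2 * n) • (z - a) ∈ superdifferential u z := by
  intro ε hε
  filter_upwards [h, Metric.ball_mem_nhds z (div_pos hε hn)] with w hw hwz
  have hexp : ‖w - a‖ ^ 2 = ‖z - a‖ ^ 2 + 2 * ⟪z - a, w - z⟫ + ‖w - z‖ ^ 2 := by
    rw [← norm_add_sq_real]
    congr 2
    abel
  rw [Metric.mem_ball, dist_eq_norm, lt_div_iff₀ hn] at hwz
  rw [hexp] at hw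
  rw [real_inner_smul_left]
  nlinarith [norm_nonneg (w - z), mul_le_mul_of_nonneg_right hwz.le (norm_nonneg (w - z))]

/-- A bound on all superdifferentials in a direction `v` integrates along segments. -/
theorem sub_le_mul_of_superdifferential_inner_le [ProperSpace E] {u : E → ℝ} {x y v : E}
    {r c T : ℝ} (hu : ContinuousOn u (Metric.closedBall x r))
    (hq : ∀ z ∈ Metric.ball x r, ∀ q ∈ superdifferential u z, ⟪q, v⟫ ≤ c)
    (hT : 0 ≤ T) (hy : y ∈ Metric.ball x r) (hyT : y + T • v ∈ Metric.ball x r) :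
    u (y + T • v) - u y ≤ c * T := by
  rcases hT.eq_or_lt with rfl | hT
  · simp
  by_contra! hlt
  obtain ⟨c', hcc', hc'⟩ := exists_between ((lt_div_iff₀ hT).2 hlt)
  rw [lt_div_iff₀ hT] at hc'
  have hK : IsCompact (Metric.closedBall x r) := isCompact_closedBall x r
  have hyK := Metric.ball_subset_closedBall hy
  obtain ⟨B, hB⟩ := hK.bddAbove_image hu
  have hB' : ∀ z ∈ Metric.closedBall x r, u z ≤ B := fun z hz => hB (mem_image_of_mem u hz)
  obtain ⟨δ₁, hδ₁, hcont⟩ := Metric.continuousOn_iff.1 hu y hyK _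
    (sub_pos.2 (show c' * T < u (y + T • v) - u y from hc'))
  obtain ⟨ρ, hρ, hρr⟩ : ∃ ρ, (dist y x ≤ ρ ∧ dist (y + T • v) x ≤ ρ) ∧ ρ < r :=
    ⟨max (dist y x) (dist (y + T • v) x), ⟨le_max_left _ _, le_max_right _ _⟩, max_lt hy hyT⟩
  have hseg : ∀ s ∈ Icc 0 T, y + s • v ∈ Metric.closedBall x ρ := by
    intro s hs
    have := (convex_closedBall x ρ).add_smul_mem (x := y) (y := T • v) hρ.1 hρ.2
      (t := s / T) ⟨div_nonneg hs.1 hT.le, (div_le_one hT).2 hs.2⟩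
    rwa [smul_smul, div_mul_cancel₀ _ hT.ne'] at this
  set δ := min δ₁ (r - ρ) with hδ
  have hδ0 : 0 < δ := lt_min hδ₁ (sub_pos.2 hρr)
  set C := B + |c'| * T - u (y + T • v) + c' * T with hC
  set n := (|C| + 1) / δ ^ 2 with hn
  have hn0 : 0 < n := by positivity
  have hnδ : C < n * δ ^ 2 := by
    rw [hn, div_mul_cancel₀ _ (by positivity)]
    linarith [le_abs_self C]
  -- Doubling of variables: the penalty ties `z` to the point `y + s • v` of the segment. Comparison
  -- with `(T, y + T • v)` gives `n * ‖z - (y + s • v)‖ ^ 2 ≤ C`, so the choice of `n` keeps `z`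
  -- within `δ` of the segment and inside the open ball.
  obtain ⟨⟨s, z⟩, ⟨hs, hz⟩, hmax⟩ :=
    ((isCompact_Icc (a := (0 : ℝ)) (b := T)).prod hK).exists_isMaxOn
      ⟨(T, y), ⟨right_mem_Icc.2 hT.le, hyK⟩⟩
      (f := fun w : ℝ × E => u w.2 - c' * w.1 - n * ‖w.2 - (y + w.1 • v)‖ ^ 2)
      (((hu.comp continuousOn_snd fun w hw => hw.2).sub (by fun_prop)).sub (by fun_prop))
  replace hmax : ∀ s' ∈ Icc 0 T, ∀ z' ∈ Metric.closedBall x r,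
      u z' - c' * s' - n * ‖z' - (y + s' • v)‖ ^ 2
        ≤ u z - c' * s - n * ‖z - (y + s • v)‖ ^ 2 := fun s' hs' z' hz' => hmax (a := (s', z'))
          ⟨hs', hz'⟩
  simp only at hs hz
  have h1 := hmax T (right_mem_Icc.2 hT.le) _ (Metric.ball_subset_closedBall hyT)
  rw [sub_self, norm_zero] at h1
  have hw : ‖z - (y + s • v)‖ < δ := by
    refine lt_of_pow_lt_pow_left₀ 2 hδ0.le (lt_of_mul_lt_mul_left ?_ hn0.le)
    have h2 : -(c' * s) ≤ |c'| * T :=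
      calc -(c' * s) = -c' * s := by ring
        _ ≤ |c'| * s := mul_le_mul_of_nonneg_right (neg_le_abs c') hs.1
        _ ≤ |c'| * T := mul_le_mul_of_nonneg_left hs.2 (abs_nonneg _)
    linarith [hB' z hz]
  have hzball : z ∈ Metric.ball x r := by
    have h3 : dist z (y + s • v) < r - ρ := by
      rw [dist_eq_norm]
      exact hw.trans_le (min_le_right _ _)
    have h4 : dist (y + s • v) x ≤ ρ := hseg s hs
    rw [Metric.mem_ball]
    linarith [dist_triangle z (y + s • v) x]
  -- At `s = 0` continuity at `y` would make the maximum smaller than the value at `(T, y + T • v)`.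
  have hs0 : 0 < s := by
    refine hs.1.lt_of_ne fun h0 => ?_
    rw [← h0, zero_smul, add_zero] at hw h1
    have h5 := hcont z hz (by rw [dist_eq_norm]; exact hw.trans_le (min_le_left _ _))
    rw [Real.dist_eq] at h5
    nlinarith [le_abs_self (u z - u y), sq_nonneg ‖z - y‖]
  have hmem : (2 * n) • (z - (y + s • v)) ∈ superdifferential u z := by
    refine smul_mem_superdifferential hn0 ?_
    filter_upwards [Metric.isOpen_ball.mem_nhds hzball] with z' hz'
    linarith [hmax s hs z' (Metric.ball_subset_closedBall hz')]
  have hle := hq z hzball _ hmem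
  rw [real_inner_smul_left] at hle
  set g := ⟪z - (y + s • v), v⟫ with hg
  -- Since `s > 0`, one may step back to `s - h` with `z` fixed. Maximality forces `c' ≤ 2 * n * g +
  -- n * h * ‖v‖ ^ 2`, whereas `2 * n * g ≤ c < c'`; `h` makes the last term less than `c' - c`.
  obtain ⟨h, hh0, hhs, hhb⟩ : ∃ h : ℝ, 0 < h ∧ h ≤ s ∧ n * h * ‖v‖ ^ 2 < c' - c := by
    refine ⟨min s ((c' - c) / (2 * (n * ‖v‖ ^ 2 + 1))), ?_, min_le_left _ _, ?_⟩
    · have := sub_pos.2 hcc'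
      positivity
    · have h6 := min_le_right s ((c' - c) / (2 * (n * ‖v‖ ^ 2 + 1)))
      rw [le_div_iff₀ (by positivity)] at h6
      have h7 : 0 < min s ((c' - c) / (2 * (n * ‖v‖ ^ 2 + 1))) := by
        have := sub_pos.2 hcc'
        positivity
      nlinarith [mul_nonneg h7.le (mul_nonneg hn0.le (sq_nonneg ‖v‖))]
  have h8 := hmax (s - h) ⟨by linarith, by linarith [hs.2]⟩ z hz
  have h9 : ‖z - (y + (s - h) • v)‖ ^ 2
      = ‖z - (y + s • v)‖ ^ 2 + 2 * (h * g) + h ^ 2 * ‖v‖ ^ 2 := by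
    rw [hg, ← real_inner_smul_right, ← mul_pow, ← abs_of_pos hh0, ← Real.norm_eq_abs,
      ← norm_smul, Real.norm_eq_abs, abs_of_pos hh0, ← norm_add_sq_real, sub_smul]
    congr 2
    abel
  rw [h9] at h8
  have h10 : h * (c' - 2 * n * g - n * h * ‖v‖ ^ 2) ≤ 0 := by nlinarith
  exact absurd h10 (not_le.2 (mul_pos hh0 (by linarith)))

/-- Test the supergradient at `z - t • q`: to first order `u` drops by at least `t * ‖q‖ ^ 2`, and
by at most `K * t * ‖q‖`. -/
lemma norm_le_of_mem_superdifferential {u : E → ℝ} {z q : E} {K : ℝ≥0} {U : Set E}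
    (hu : LipschitzOnWith K u U) (hU : U ∈ 𝓝 z) (hq : q ∈ superdifferential u z) :
    ‖q‖ ≤ K := by
  rcases (norm_nonneg q).eq_or_lt with h0 | h0
  · rw [← h0]; exact K.2
  refine le_of_forall_pos_le_add fun ε hε => ?_
  have ht : Tendsto (fun t : ℝ => z - t • q) (𝓝[>] 0) (𝓝 z) := by
    refine tendsto_nhdsWithin_of_tendsto_nhds ?_
    have : Continuous fun t : ℝ => z - t • q := by fun_prop
    simpa using this.tendsto 0
  obtain ⟨t, ht1, ht2, ht0⟩ :=
    ((ht.eventually (hq ε hε)).and ((ht.eventually hU).and self_mem_nhdsWithin)).exists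
  have ht0' : (0 : ℝ) < t := ht0
  have h1 := hu.dist_le_mul _ ht2 _ (mem_of_mem_nhds hU)
  rw [Real.dist_eq, dist_eq_norm, sub_sub_cancel_left, norm_neg, norm_smul, Real.norm_eq_abs,
    abs_of_pos ht0'] at h1
  rw [sub_sub_cancel_left, inner_neg_right, real_inner_smul_right, real_inner_self_eq_norm_sq,
    norm_neg, norm_smul, Real.norm_eq_abs, abs_of_pos ht0'] at ht1
  have h2 := neg_abs_le (u (z - t • q) - u z)
  refine le_of_mul_le_mul_left ?_ (mul_pos ht0' h0)
  nlinarith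

lemma inner_nonneg_of_mem_superdifferential {u : E → ℝ} {z q e : E}
    (hu : ∀ᶠ t in 𝓝[>] (0 : ℝ), u z ≤ u (z + t • e)) (hq : q ∈ superdifferential u z) :
    0 ≤ ⟪q, e⟫ := by
  refine le_of_forall_pos_le_add fun ε hε => ?_
  have ht : Tendsto (fun t : ℝ => z + t • e) (𝓝[>] 0) (𝓝 z) := by
    refine tendsto_nhdsWithin_of_tendsto_nhds ?_
    have : Continuous fun t : ℝ => z + t • e := by fun_prop
    simpa using this.tendsto 0
  obtain ⟨t, ht1, ht2, ht0⟩ :=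
    ((ht.eventually (hq (ε / (‖e‖ + 1)) (by positivity))).and (hu.and self_mem_nhdsWithin)).exists
  have ht0' : (0 : ℝ) < t := ht0
  rw [add_sub_cancel_left, real_inner_smul_right, norm_smul, Real.norm_eq_abs,
    abs_of_pos ht0'] at ht1
  have h1 : ε / (‖e‖ + 1) * ‖e‖ ≤ ε := by
    rw [div_mul_eq_mul_div, div_le_iff₀ (by positivity)]
    nlinarith
  refine le_of_mul_le_mul_left ?_ ht0'
  nlinarith

/-! ### Semidifferentials of a finite minimum -/

section iInf

variable {ι : Type*} [Finite ι] {u : ι → E → ℝ} {x p : E}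

lemma subdifferential_iInf_subset {i : ι} (hi : u i x = ⨅ j, u j x) :
    subdifferential (fun y => ⨅ j, u j y) x ⊆ subdifferential (u i) x := by
  intro p hp ε hε
  filter_upwards [hp ε hε] with y hy
  have := ciInf_le (finite_range fun j => u j y).bddBelow i
  simp only [← hi] at hy
  linarith

lemma superdifferential_iInf_subset_of_forall_lt [Nonempty ι] {i : ι}
    (hu : ∀ j, ContinuousAt (u j) x)
    (hi : ∀ j, j ≠ i → u i x < u j x) :
    superdifferential (fun y => ⨅ j, u j y) x ⊆ superdifferential (u i) x := by
  have h : ∀ y, (∀ j, j ≠ i → u i y < u j y) → ⨅ j, u j y = u i y := fun y hy =>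
    le_antisymm (ciInf_le (finite_range fun j => u j y).bddBelow i) <| le_ciInf fun j => by
      by_cases hj : j = i
      · rw [hj]
      · exact (hy j hj).le
  have hev : ∀ᶠ y in 𝓝 x, ∀ j, j ≠ i → u i y < u j y := by
    refine eventually_all.2 fun j => ?_
    by_cases hj : j = i
    · simp [hj]
    · exact ((hu i).eventually_lt (hu j) (hi j hj)).mono fun y hy _ => hy
  intro p hp ε hε
  filter_upwards [hp ε hε, hev] with y hy1 hy2
  simpa only [h y hy2, h x hi] using hy1

/-- One-sided bounds for the active functions bound the superdifferential of a minimum. -/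
lemma inner_le_of_mem_superdifferential_iInf [Nonempty ι] {v : E} {c : ℝ}
    (hu : ∀ j, ContinuousAt (u j) x)
    (hc : ∀ i, u i x = ⨅ j, u j x → ∀ c', c < c' →
      ∀ᶠ t in 𝓝[>] (0 : ℝ), u i x - u i (x - t • v) ≤ c' * t)
    (hp : p ∈ superdifferential (fun y => ⨅ j, u j y) x) : ⟪p, v⟫ ≤ c := by
  refine le_of_forall_pos_le_add fun ε hε => ?_
  have ht : Tendsto (fun t : ℝ => x - t • v) (𝓝[>] 0) (𝓝 x) := by
    refine tendsto_nhdsWithin_of_tendsto_nhds ?_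
    have : Continuous fun t : ℝ => x - t • v := by fun_prop
    simpa using this.tendsto 0
  obtain ⟨i₀, hi₀⟩ := exists_eq_ciInf_of_finite (f := fun j => u j x)
  -- The second alternative, for functions inactive at `x`, says that `i` does not attain the
  -- minimum at `x - t • v`; the minimizing index there thus satisfies the first.
  have hact : ∀ᶠ t in 𝓝[>] (0 : ℝ), ∀ i,
      (⨅ j, u j x) - u i (x - t • v) ≤ (c + ε / 2) * t ∨ u i₀ (x - t • v) < u i (x - t • v) := by
    refine eventually_all.2 fun i => ?_
    by_cases hi : u i x = ⨅ j, u j x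
    · filter_upwards [hc i hi (c + ε / 2) (by linarith)] with t ht
      rw [← hi]
      exact Or.inl ht
    · have hlt : u i₀ x < u i x := by
        rw [hi₀]
        exact lt_of_le_of_ne (ciInf_le (finite_range fun j => u j x).bddBelow i) (Ne.symm hi)
      exact (ht.eventually ((hu i₀).eventually_lt (hu i) hlt)).mono fun t h => Or.inr h
  obtain ⟨t, ht1, ht2, ht0⟩ := ((ht.eventually (hp (ε / 2 / (‖v‖ + 1)) (by positivity))).and
    (hact.and self_mem_nhdsWithin)).exists
  have ht0' : (0 : ℝ) < t := ht0
  obtain ⟨i, hi⟩ := exists_eq_ciInf_of_finite (f := fun j => u j (x - t • v))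
  have h2 : (⨅ j, u j x) - u i (x - t • v) ≤ (c + ε / 2) * t := by
    refine (ht2 i).resolve_right fun h => ?_
    have := ciInf_le (finite_range fun j => u j (x - t • v)).bddBelow i₀
    rw [← hi] at this
    exact absurd h (not_lt.2 this)
  rw [sub_sub_cancel_left, inner_neg_right, real_inner_smul_right, norm_neg, norm_smul,
    Real.norm_eq_abs, abs_of_pos ht0'] at ht1
  simp only [← hi] at ht1
  have h1 : ε / 2 / (‖v‖ + 1) * ‖v‖ ≤ ε / 2 := by
    rw [div_mul_eq_mul_div, div_le_iff₀ (by positivity)]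
    nlinarith
  refine le_of_mul_le_mul_left ?_ ht0'
  nlinarith

end iInf

end Viscosity

/-! ### The scalar velocity equation: existence and comparison -/

namespace PursuitEvasion

/-- The exponential weight makes integration gain a factor `1 / (2 * k)`; against a Lipschitz
constant `k` the Picard map contracts by `1 / 2` on the whole half-line. -/
lemma exp_neg_mul_abs_integral_le {h : ℝ → ℝ} {k C t : ℝ} (hk : 0 < k) (hC : 0 ≤ C) (ht : 0 ≤ t)
    (hh : ∀ᵐ s, s ∈ Ioc 0 t → |h s| ≤ C * Real.exp (2 * k * s)) :
    Real.exp (-(2 * k * t)) * |∫ s in (0 : ℝ)..t, h s| ≤ C / (2 * k) := by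
  have h1 : |∫ s in (0 : ℝ)..t, h s| ≤ ∫ s in (0 : ℝ)..t, C * Real.exp (2 * k * s) :=
    Real.norm_eq_abs (∫ s in (0 : ℝ)..t, h s) ▸
      intervalIntegral.norm_integral_le_of_norm_le ht hh <|
      (by fun_prop : Continuous fun s => C * Real.exp (2 * k * s)).intervalIntegrable _ _
  have h2 : ∫ s in (0 : ℝ)..t, C * Real.exp (2 * k * s)
      = C * ((Real.exp (2 * k * t) - 1) / (2 * k)) := by
    rw [intervalIntegral.integral_const_mul,
      intervalIntegral.integral_comp_mul_left (fun s => Real.exp s) (by positivity : 2 * k ≠ 0),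
      integral_exp, mul_zero, Real.exp_zero, smul_eq_mul, inv_mul_eq_div]
  rw [h2] at h1
  calc _ ≤ Real.exp (-(2 * k * t)) * (C * ((Real.exp (2 * k * t) - 1) / (2 * k))) := by gcongr
    _ = C / (2 * k) * (1 - Real.exp (-(2 * k * t))) := by
      have : Real.exp (-(2 * k * t)) * Real.exp (2 * k * t) = 1 := by
        rw [← Real.exp_add]; simp
      linear_combination (C / (2 * k)) * this
    _ ≤ C / (2 * k) :=
      mul_le_of_le_one_right (by positivity) (by linarith [Real.exp_pos (-(2 * k * t))])

lemma intervalIntegrable_of_ae_abs_le {a : ℝ → ℝ} {α t : ℝ} (ha : Measurable a)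
    (hα : ∀ᵐ s ∂(volume.restrict (Ici (0 : ℝ))), |a s| ≤ α) (ht : 0 ≤ t) :
    IntervalIntegrable a volume 0 t := by
  rw [intervalIntegrable_iff_integrableOn_Ioc_of_le ht]
  refine Integrable.of_bound ha.aestronglyMeasurable α ?_
  exact ae_restrict_of_ae_restrict_of_subset (fun s hs => hs.1.le) hα

lemma lipschitzWith_of_abs_le {g : ℝ → ℝ} {k : ℝ} (hk : 0 ≤ k)
    (hg : ∀ y y', |g y - g y'| ≤ k * |y - y'|) : LipschitzWith k.toNNReal g :=
  LipschitzWith.of_dist_le_mul fun y y' => by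
    simpa only [Real.dist_eq, Real.coe_toNNReal k hk] using hg y y'

/-- Global Carathéodory solutions of `v' = -g(v) + a` for Lipschitz `g` and bounded measurable
`a`. -/
theorem exists_integral_solution {g a : ℝ → ℝ} {k α : ℝ} (hk : 0 < k) (hα0 : 0 ≤ α)
    (hg : ∀ y y', |g y - g y'| ≤ k * |y - y'|) (ha : Measurable a)
    (hα : ∀ᵐ s ∂(volume.restrict (Ici (0 : ℝ))), |a s| ≤ α) (v₀ : ℝ) :
    ∃ v : ℝ → ℝ, Continuous v ∧
      ∀ t, 0 ≤ t → v t = v₀ + ∫ s in (0 : ℝ)..t, (-g (v s) + a s) := by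
  have hgc : Continuous g := (lipschitzWith_of_abs_le hk.le hg).continuous
  set e : ℝ → ℝ := fun s => Real.exp (2 * k * s) with he
  have hec : Continuous e := by fun_prop
  set a' : ℝ → ℝ := (Ici (0 : ℝ)).indicator a with ha'
  have ha'b : ∀ᵐ s, |a' s| ≤ α := by
    filter_upwards [(ae_restrict_iff' measurableSet_Ici).1 hα] with s hs
    by_cases h : s ∈ Ici (0 : ℝ)
    · rw [ha', indicator_of_mem h]; exact hs h
    · rw [ha', indicator_of_notMem h, abs_zero]; exact hα0
  have ha'm : Measurable a' := ha.indicator measurableSet_Ici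
  have ha'i : ∀ s t, IntervalIntegrable a' volume s t := fun s t => by
    rw [intervalIntegrable_iff]
    exact Measure.integrableOn_of_bounded (by simp) ha'm.aestronglyMeasurable
      (ae_restrict_of_ae ha'b)
  -- The unknown is `w = v / e`, so the sup norm of `w` is the weighted norm of `v`.
  let f : BoundedContinuousFunction ℝ ℝ → ℝ → ℝ := fun w s => -g (e s * w s) + a' s
  have hfi : ∀ w s t, IntervalIntegrable (f w) volume s t := fun w s t =>
    (Continuous.intervalIntegrable (by fun_prop) _ _).add (ha'i s t)
  have hbound : ∀ w : BoundedContinuousFunction ℝ ℝ, ∀ t, 0 ≤ t →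
      Real.exp (-(2 * k * t)) * |∫ s in (0 : ℝ)..t, f w s|
        ≤ (|g 0| + α + k * ‖w‖) / (2 * k) := by
    intro w t ht
    refine exp_neg_mul_abs_integral_le hk (by positivity) ht ?_
    filter_upwards [ha'b] with s hs hst
    have h1 : 1 ≤ e s := Real.one_le_exp (by nlinarith [hst.1])
    have h2 := hg (e s * w s) 0
    rw [sub_zero, abs_mul, abs_of_pos (Real.exp_pos _ : 0 < e s)] at h2
    have h3 : |w s| ≤ ‖w‖ := w.norm_coe_le_norm s
    have h4 : |f w s| ≤ |g 0| + k * (e s * |w s|) + α := by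
      have h5 : |g (e s * w s)| ≤ |g 0| + |g (e s * w s) - g 0| := by
        have := abs_add_le (g 0) (g (e s * w s) - g 0)
        rwa [add_sub_cancel] at this
      calc |f w s| ≤ |-g (e s * w s)| + |a' s| := abs_add_le _ _
        _ ≤ _ := by rw [abs_neg]; linarith
    have h6 : k * (e s * |w s|) ≤ k * (e s * ‖w‖) := by gcongr
    nlinarith [abs_nonneg (g 0)]
  -- Picard map in the weighted unknown; `max t 0` freezes it at negative times so that it is
  -- bounded on all of `ℝ`.
  let Tf : BoundedContinuousFunction ℝ ℝ → ℝ → ℝ := fun w t =>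
    Real.exp (-(2 * k * max t 0)) * (v₀ + ∫ s in (0 : ℝ)..(max t 0), f w s)
  have hTc : ∀ w, Continuous (Tf w) := fun w => by
    have h1 : Continuous fun t => ∫ s in (0 : ℝ)..t, f w s :=
      intervalIntegral.continuous_primitive (hfi w) 0
    have h2 : Continuous fun t : ℝ => max t 0 := by fun_prop
    exact (by fun_prop : Continuous fun t : ℝ => Real.exp (-(2 * k * max t 0))).mul
      (continuous_const.add (h1.comp h2))
  have hTb : ∀ w t, ‖Tf w t‖ ≤ |v₀| + (|g 0| + α + k * ‖w‖) / (2 * k) := fun w t => by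
    have h0 : 0 ≤ max t 0 := le_max_right _ _
    rw [Real.norm_eq_abs, abs_mul, abs_of_pos (Real.exp_pos _)]
    have h1 : Real.exp (-(2 * k * max t 0)) ≤ 1 := Real.exp_le_one_iff.2 (by nlinarith)
    calc _ ≤ Real.exp (-(2 * k * max t 0)) * (|v₀| + |∫ s in (0 : ℝ)..(max t 0), f w s|) := by
          gcongr; exact abs_add_le _ _
      _ ≤ _ := by
        rw [mul_add]
        exact add_le_add (mul_le_of_le_one_left (abs_nonneg _) h1) (hbound w _ h0)
  let T : BoundedContinuousFunction ℝ ℝ → BoundedContinuousFunction ℝ ℝ := fun w =>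
    BoundedContinuousFunction.ofNormedAddCommGroup (Tf w) (hTc w) _ (hTb w)
  have hT : ContractingWith (1 / 2) T := by
    refine ⟨by rw [← NNReal.coe_lt_coe]; norm_num, LipschitzWith.of_dist_le_mul fun w w' => ?_⟩
    refine (BoundedContinuousFunction.dist_le (by positivity)).2 fun t => ?_
    have h0 : 0 ≤ max t 0 := le_max_right _ _
    have h1 : T w t - T w' t = Real.exp (-(2 * k * max t 0)) *
        ∫ s in (0 : ℝ)..(max t 0), (f w s - f w' s) := by
      rw [intervalIntegral.integral_sub (hfi _ _ _) (hfi _ _ _)]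
      change Tf w t - Tf w' t = _
      simp only [Tf]
      ring
    rw [Real.dist_eq, h1, abs_mul, abs_of_pos (Real.exp_pos _)]
    refine (exp_neg_mul_abs_integral_le hk (C := k * dist w w') (by positivity) h0 ?_).trans
      (le_of_eq ?_)
    · refine ae_of_all _ fun s _ => ?_
      have h2 : f w s - f w' s = -(g (e s * w s) - g (e s * w' s)) := by simp only [f]; ring
      have h3 := hg (e s * w s) (e s * w' s)
      rw [← mul_sub, abs_mul, abs_of_pos (Real.exp_pos _ : 0 < e s)] at h3
      have h4 : |w s - w' s| ≤ dist w w' :=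
        BoundedContinuousFunction.dist_coe_le_dist (f := w) (g := w') s
      have h5 : k * (e s * |w s - w' s|) ≤ k * (e s * dist w w') := by
        have : 0 < e s := Real.exp_pos _
        gcongr
      rw [h2, abs_neg]
      calc _ ≤ _ := h3
        _ ≤ _ := h5
        _ = _ := by ring
    · push_cast
      field_simp
  have hfix := hT.fixedPoint_isFixedPt
  set w := ContractingWith.fixedPoint T hT
  refine ⟨fun t => e t * w t, by fun_prop, fun t ht => ?_⟩
  have h1 : w t = Tf w t := by
    conv_lhs => rw [← hfix.eq]
    rfl
  simp only [h1, Tf, max_eq_left ht]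
  rw [← mul_assoc, he]
  simp only
  rw [← Real.exp_add, add_neg_cancel, Real.exp_zero, one_mul]
  congr 1
  refine intervalIntegral.integral_congr fun s hs => ?_
  rw [uIcc_of_le ht] at hs
  simp only [f, ha', indicator_of_mem (show s ∈ Ici (0 : ℝ) from hs.1), he]

/-- Comparison of solutions of `v' = -g(v) + a` with ordered initial values. -/
theorem integral_solution_le {g a v v' : ℝ → ℝ} {k α v₀ v₀' : ℝ} (hk : 0 < k)
    (hg : ∀ y y', |g y - g y'| ≤ k * |y - y'|) (ha : Measurable a)
    (hα : ∀ᵐ s ∂(volume.restrict (Ici (0 : ℝ))), |a s| ≤ α) (h₀ : v₀ ≤ v₀')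
    (hvc : ContinuousOn v (Ici 0)) (hvc' : ContinuousOn v' (Ici 0))
    (hv : ∀ t, 0 ≤ t → v t = v₀ + ∫ s in (0 : ℝ)..t, (-g (v s) + a s))
    (hv' : ∀ t, 0 ≤ t → v' t = v₀' + ∫ s in (0 : ℝ)..t, (-g (v' s) + a s))
    {t : ℝ} (ht : 0 ≤ t) : v t ≤ v' t := by
  have hgc : Continuous g := (lipschitzWith_of_abs_le hk.le hg).continuous
  have hcg : ContinuousOn (fun s => g (v' s) - g (v s)) (Ici 0) :=
    (hgc.comp_continuousOn hvc').sub (hgc.comp_continuousOn hvc)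
  have hint : ∀ {w : ℝ → ℝ}, ContinuousOn w (Ici 0) → ∀ r, 0 ≤ r →
      IntervalIntegrable (fun s => -g (w s)) volume 0 r := fun hw r hr =>
    ContinuousOn.intervalIntegrable <| ((hgc.comp_continuousOn hw).neg).mono
      (by rw [uIcc_of_le hr]; exact Icc_subset_Ici_self)
  have hdiff : ∀ r, 0 ≤ r → v r - v' r = (v₀ - v₀') + ∫ s in (0 : ℝ)..r, (g (v' s) - g (v s)) := by
    intro r hr
    have hi := intervalIntegrable_of_ae_abs_le ha hα hr
    rw [hv r hr, hv' r hr, intervalIntegral.integral_add (hint hvc r hr) hi,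
      intervalIntegral.integral_add (hint hvc' r hr) hi]
    have : ∫ s in (0 : ℝ)..r, (g (v' s) - g (v s))
        = (∫ s in (0 : ℝ)..r, -g (v s)) - ∫ s in (0 : ℝ)..r, -g (v' s) := by
      rw [← intervalIntegral.integral_sub (hint hvc r hr) (hint hvc' r hr)]
      exact intervalIntegral.integral_congr fun s _ => by ring
    rw [this]
    ring
  have hderiv : ∀ r ∈ Ico 0 t,
      HasDerivWithinAt (fun r => v r - v' r) (g (v' r) - g (v r)) (Ici r) r := by
    intro r hr
    have h1 : HasDerivWithinAt (fun r => ∫ s in (0 : ℝ)..r, (g (v' s) - g (v s)))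
        (g (v' r) - g (v r)) (Ici r) r := by
      refine intervalIntegral.integral_hasDerivWithinAt_right
        (ContinuousOn.intervalIntegrable (hcg.mono ?_)) (t := Ioi r) ?_ ?_
      · rw [uIcc_of_le hr.1]; exact Icc_subset_Ici_self
      · exact ⟨Ioi r, self_mem_nhdsWithin, (hcg.mono fun s hs => hr.1.trans
          (le_of_lt hs)).aestronglyMeasurable measurableSet_Ioi⟩
      · exact (hcg r hr.1).mono fun s hs => hr.1.trans (le_of_lt hs)
    exact (h1.const_add (v₀ - v₀')).congr (fun s hs => hdiff s (hr.1.trans hs)) (hdiff r hr.1)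
  refine sub_nonpos.1 (le_of_forall_pos_le_add fun ε hε => ?_)
  -- The barrier `η * exp ((k + 1) * r)` equals `ε` at `r = t`. Its rate `k + 1` exceeds `k`, so at
  -- a contact point it grows strictly faster than `v - v'`.
  set η := ε * Real.exp (-((k + 1) * t)) with hη
  have hη0 : 0 < η := by positivity
  have key := image_le_of_deriv_right_lt_deriv_boundary (a := 0) (b := t)
    (f := fun r => v r - v' r) (f' := fun r => g (v' r) - g (v r))
    (B := fun r => η * Real.exp ((k + 1) * r))
    (B' := fun r => η * (Real.exp ((k + 1) * r) * ((k + 1) * 1)))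
    ((hvc.sub hvc').mono Icc_subset_Ici_self) hderiv
    (by
      have := hdiff 0 le_rfl
      simp only [intervalIntegral.integral_same, add_zero] at this
      simp only [this, mul_zero, Real.exp_zero, mul_one]
      linarith)
    (fun r => ((((hasDerivAt_id r).const_mul (k + 1)).exp).const_mul η))
    (by
      intro r _ hreq
      have hpos : 0 < η * Real.exp ((k + 1) * r) := by positivity
      have h1 := hg (v' r) (v r)
      rw [abs_sub_comm (v' r), hreq, abs_of_pos hpos] at h1
      have h2 := le_abs_self (g (v' r) - g (v r))
      linarith)
    (right_mem_Icc.2 ht)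
  simp only [hη, mul_assoc] at key
  rwa [← Real.exp_add, neg_add_cancel, Real.exp_zero, mul_one, ← zero_add ε] at key

/-! ### Monotonicity of the value in the evader's state -/

variable {m : ℕ}

/-- Slowing the evader down initially can only help the pursuers. -/
lemma payoff_le_payoff {d : Fin (m + 1) → ℝ → ℝ} {kd α : ℝ} {x x' : State m} {a : ℝ → ℝ}
    {b : ℝ → Fin m → ℝ} {i : Fin m} (hkd : 0 < kd) (hα0 : 0 ≤ α)
    (hd : ∀ k y y', |d k y - d k y'| ≤ kd * |y - y'|) (ha : Measurable a)
    (hα : ∀ᵐ s ∂(volume.restrict (Ici (0 : ℝ))), |a s| ≤ α)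
    (hx : ∀ k : Fin (m + 1) × Fin 2, k.1 ≠ 0 → x k = x' k)
    (hx₀ : x (0, 0) ≤ x' (0, 0)) (hx₁ : x (0, 1) ≤ x' (0, 1)) :
    payoff d (target i) x a b ≤ payoff d (target i) x' a b := by
  refine le_iInf₂ fun y' hy' => ?_
  obtain ⟨v, hvc, hv⟩ := exists_integral_solution hkd hα0 (hd 0) ha hα (x (0, 1))
  have hcoord : ∀ k, ContinuousOn (fun t => y' t k) (Ici 0) := fun k =>
    (PiLp.continuous_apply 2 (fun _ => ℝ) k).comp_continuousOn hy'.1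
  have hv' : ∀ t, 0 ≤ t → v t ≤ y' t (0, 1) := fun t ht =>
    integral_solution_le hkd (hd 0) ha hα hx₁ hvc.continuousOn (hcoord (0, 1)) hv
      (fun t ht => by simpa [dynamics] using hy'.2 t ht (0, 1)) ht
  -- The players are decoupled, so only the evader's coordinates change; the new evader stays behind
  -- the old one.
  let y : ℝ → State m := fun t => WithLp.toLp 2 fun k =>
    if k.1 = 0 then if k.2 = 0 then x (0, 0) + ∫ s in (0 : ℝ)..t, v s else v t else y' t k
  have hy : IsTrajectory d x a b y := by
    constructor
    · refine (PiLp.continuous_toLp 2 _).comp_continuousOn (continuousOn_pi.2 fun k => ?_)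
      by_cases h0 : k.1 = 0
      · by_cases h1 : k.2 = 0
        · simp only [h0, h1, if_true]
          exact (continuous_const.add (intervalIntegral.continuous_primitive
            (fun _ _ => hvc.intervalIntegrable _ _) 0)).continuousOn
        · simp only [h0, h1, if_true, if_false]
          exact hvc.continuousOn
      · simp only [h0, if_false]
        exact hcoord k
    · rintro t ht ⟨k, l⟩
      by_cases h0 : k = 0
      · subst h0
        fin_cases l
        · simp [y, dynamics]
        · simpa [y, dynamics] using hv t ht
      · have h1 := hy'.2 t ht (k, l)
        simp only [y, dynamics, h0, if_false] at h1 ⊢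
        rw [h1, hx (k, l) h0]
  refine iInf₂_le_of_le y hy (iInf_mono fun t => iInf_mono' fun ht => ⟨?_, le_rfl⟩)
  have h1 : x (0, 0) + ∫ s in (0 : ℝ)..t, v s ≤ y' t (0, 0) := by
    rw [hy'.2 t t.2 (0, 0)]
    simp only [dynamics, if_true]
    refine add_le_add hx₀ (intervalIntegral.integral_mono_on t.2 (hvc.intervalIntegrable _ _) ?_
      fun s hs => hv' s hs.1)
    refine ((hcoord (0, 1)).mono ?_).intervalIntegrable
    rw [uIcc_of_le t.coe_nonneg]
    exact Icc_subset_Ici_self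
  have h2 : y' t (0, 0) ≤ y' t (i.succ, 0) := ht
  change y t (0, 0) ≤ y t (i.succ, 0)
  simp only [y, if_true, Fin.succ_ne_zero, if_false]
  exact h1.trans h2

/-- Strategies and controls do not refer to the initial state, so the payoffs are compared for the
same `φ` and `b`. -/
lemma upperValue_le_upperValue {d : Fin (m + 1) → ℝ → ℝ} {kd α : ℝ} {β : Fin m → ℝ}
    {x x' : State m} {i : Fin m} (hkd : 0 < kd) (hα0 : 0 ≤ α)
    (hd : ∀ k y y', |d k y - d k y'| ≤ kd * |y - y'|)
    (hx : ∀ k : Fin (m + 1) × Fin 2, k.1 ≠ 0 → x k = x' k)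
    (hx₀ : x (0, 0) ≤ x' (0, 0)) (hx₁ : x (0, 1) ≤ x' (0, 1)) :
    upperValue d α β (target i) x ≤ upperValue d α β (target i) x' :=
  iSup_mono fun φ => iInf_mono fun b =>
    payoff_le_payoff hkd hα0 hd (φ.1 b).2.1 (φ.1 b).2.2 hx hx₀ hx₁

/-! ### The Hamiltonian and decay along fixed controls -/

lemma isOpen_compl_target (i : Fin m) : IsOpen (target i)ᶜ := by
  have h : IsClosed (target i) := isClosed_le (by fun_prop) (by fun_prop)
  exact h.isOpen_compl

lemma continuous_dynamics {d : Fin (m + 1) → ℝ → ℝ} (hd : ∀ k, Continuous (d k)) (a : ℝ)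
    (b : Fin m → ℝ) : Continuous fun x : State m => dynamics d x a b := by
  refine (PiLp.continuous_toLp 2 _).comp (continuous_pi fun k => ?_)
  have := hd k.1
  split_ifs <;> fun_prop

lemma inner_neg_dynamics (d : Fin (m + 1) → ℝ → ℝ) (x p : State m) (a : ℝ) (b : Fin m → ℝ) :
    ⟪p, -dynamics d x a b⟫
      = (∑ k : Fin (m + 1), (-(p (k, 0) * x (k, 1)) + p (k, 1) * d k (x (k, 1))))
        - a * p (0, 1) - ∑ i : Fin m, b i * p (i.succ, 1) := by
  have h : a * p (0, 1) + ∑ i : Fin m, b i * p (i.succ, 1)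
      = ∑ k : Fin (m + 1), (Fin.cons a b : Fin (m + 1) → ℝ) k * p (k, 1) := by
    simp [Fin.sum_univ_succ]
  rw [sub_sub, h, ← Finset.sum_sub_distrib, PiLp.inner_apply, Fintype.sum_prod_type]
  refine Finset.sum_congr rfl fun k _ => ?_
  simp [Fin.sum_univ_two, dynamics]
  ring

lemma inner_neg_dynamics_le_of_hamiltonian_nonpos {d : Fin (m + 1) → ℝ → ℝ} {α : ℝ}
    {β b : Fin m → ℝ} {x p : State m} {r : ℝ} (hp : 0 ≤ p (0, 1)) (hb : ∀ i, |b i| ≤ β i)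
    (h : hamiltonian d α β x r p ≤ 0) : ⟪p, -dynamics d x α b⟫ ≤ 1 := by
  rw [inner_neg_dynamics]
  rw [hamiltonian, abs_of_nonneg hp] at h
  have : -∑ i : Fin m, b i * p (i.succ, 1) ≤ ∑ i : Fin m, β i * |p (i.succ, 1)| := by
    rw [← Finset.sum_neg_distrib]
    refine Finset.sum_le_sum fun i _ => (neg_le_abs _).trans ?_
    rw [abs_mul]
    exact mul_le_mul_of_nonneg_right (hb i) (abs_nonneg _)
  linarith

/-- No sign of `p (0, 1)` is needed here, since `-α * |p (0, 1)| ≤ -α * p (0, 1)`; this matters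
because `p` will be a supergradient of the minimum. The extremal control of the pursuers is
bang-bang. -/
lemma hamiltonian_nonpos_of_forall_inner_neg_dynamics_le {d : Fin (m + 1) → ℝ → ℝ} {α : ℝ}
    {β : Fin m → ℝ} {x p : State m} (r : ℝ) (hα : 0 ≤ α) (hβ : ∀ i, 0 ≤ β i)
    (h : ∀ b : Fin m → ℝ, (∀ i, |b i| ≤ β i) → ⟪p, -dynamics d x α b⟫ ≤ 1) :
    hamiltonian d α β x r p ≤ 0 := by
  have h1 := h (fun i => -(β i * SignType.sign (p (i.succ, 1)))) fun i => by
    rw [abs_neg, abs_mul, abs_of_nonneg (hβ i)]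
    refine mul_le_of_le_one_right (hβ i) ?_
    rcases SignType.sign (p (i.succ, 1)) <;> simp
  rw [inner_neg_dynamics] at h1
  have h2 : ∑ i : Fin m, -(β i * SignType.sign (p (i.succ, 1))) * p (i.succ, 1)
      = -∑ i : Fin m, β i * |p (i.succ, 1)| := by
    rw [← Finset.sum_neg_distrib]
    refine Finset.sum_congr rfl fun i _ => ?_
    rw [neg_mul, mul_assoc, sign_mul_self]
  rw [h2] at h1
  rw [hamiltonian]
  have := mul_le_mul_of_nonneg_left (le_abs_self (p (0, 1))) hα
  linarith

/-- Along a fixed control of the pursuers, a Lipschitz subsolution that is monotone in the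
velocity of the evader decreases at rate at most one, up to a small error. -/
lemma eventually_sub_le_of_isSubsolution {d : Fin (m + 1) → ℝ → ℝ} {α : ℝ} {β b : Fin m → ℝ}
    {w : State m → ℝ} {Ω : Set (State m)} {x : State m} {c : ℝ} (hd : ∀ k, Continuous (d k))
    (hΩ : IsOpen Ω) (hw : Viscosity.IsSubsolution (hamiltonian d α β) Ω w)
    (hmono : ∀ z ∈ Ω, ∀ᶠ t in 𝓝[>] (0 : ℝ), w z ≤ w (z + t • EuclideanSpace.single (0, 1) 1))
    (hx : x ∈ Ω) (hlip : Viscosity.LipschitzNear w x) (hb : ∀ i, |b i| ≤ β i) (hc : 1 < c) :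
    ∀ᶠ t in 𝓝[>] (0 : ℝ), w x - w (x - t • (-dynamics d x α b)) ≤ c * t := by
  obtain ⟨K, U, hU, hK⟩ := hlip
  set v := -dynamics d x α b with hv
  -- The direction `v` is frozen at `x`. Supergradients nearby are bounded by `K`, so replacing the
  -- dynamics at `z` by those at `x` costs less than `c - 1`.
  have hf : ∀ᶠ z in 𝓝 x, K * ‖dynamics d z α b - dynamics d x α b‖ < c - 1 := by
    have h1 : Continuous fun z => K * ‖dynamics d z α b - dynamics d x α b‖ := by
      have := continuous_dynamics hd α b
      fun_prop
    exact h1.continuousAt.eventually_lt continuousAt_const (by simpa using hc)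
  obtain ⟨r, hr, hball⟩ := Metric.nhds_basis_closedBall.mem_iff.1
    (inter_mem (hΩ.mem_nhds hx) (inter_mem (interior_mem_nhds.2 hU) hf))
  have ht : Tendsto (fun t : ℝ => x - t • v) (𝓝[>] 0) (𝓝 x) := by
    refine tendsto_nhdsWithin_of_tendsto_nhds ?_
    have : Continuous fun t : ℝ => x - t • v := by fun_prop
    simpa using this.tendsto 0
  filter_upwards [ht.eventually (Metric.ball_mem_nhds x hr), self_mem_nhdsWithin] with t hy ht0
  have key := Viscosity.sub_le_mul_of_superdifferential_inner_le (u := w) (x := x)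
    (y := x - t • v) (v := v) (r := r) (c := c) (T := t)
    (hw.1.mono fun z hz => (hball hz).1) ?_ (le_of_lt ht0) hy
    (by rw [sub_add_cancel]; exact Metric.mem_ball_self hr)
  · rwa [sub_add_cancel] at key
  intro z hz q hq
  obtain ⟨hzΩ, hzU, hzf⟩ := hball (Metric.ball_subset_closedBall hz)
  have hqK := Viscosity.norm_le_of_mem_superdifferential hK (mem_interior_iff_mem_nhds.1 hzU) hq
  have hq0 : 0 ≤ q (0, 1) := by
    have := Viscosity.inner_nonneg_of_mem_superdifferential (hmono z hzΩ) hq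
    rwa [EuclideanSpace.inner_single_right, one_mul] at this
  have h1 := inner_neg_dynamics_le_of_hamiltonian_nonpos hq0 hb (hw.2 z hzΩ q hq)
  have h2 : ⟪q, v⟫ = ⟪q, -dynamics d z α b⟫ + ⟪q, dynamics d z α b - dynamics d x α b⟫ := by
    rw [← inner_add_right, hv]
    congr 1
    abel
  have h3 := real_inner_le_norm q (dynamics d z α b - dynamics d x α b)
  have h4 := mul_le_mul_of_nonneg_right hqK (norm_nonneg (dynamics d z α b - dynamics d x α b))
  have h5 : K * ‖dynamics d z α b - dynamics d x α b‖ < c - 1 := hzf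
  linarith

end PursuitEvasion

/-! ### The minimum of the values -/

theorem mainTheorem3 (m : ℕ) (hm : 1 ≤ m)
    (d : Fin (m + 1) → ℝ → ℝ) (kd cd α : ℝ) (β : Fin m → ℝ)
    (hkd : 0 < kd) (hcd : 0 < cd) (hα : 0 < α)
    (hd_lip : ∀ k y y', |d k y - d k y'| ≤ kd * |y - y'|)
    (hd_le : ∀ k y, d k y ≤ cd)
    (hβ : ∀ i, α + 2 * cd < β i)
    (u : Fin m → PursuitEvasion.State m → ℝ)
    (hu : ∀ i, ∀ x ∈ (PursuitEvasion.target i)ᶜ,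
      (PursuitEvasion.upperValue d α β (PursuitEvasion.target i) x : EReal) = (u i x : EReal))
    (ha : ∀ i, Viscosity.IsSolution (PursuitEvasion.hamiltonian d α β)
      (PursuitEvasion.target i)ᶜ (u i))
    (hb : ∀ i j, i ≠ j → ∀ x ∈ (⋃ k : Fin m, PursuitEvasion.target k)ᶜ, u i x = u j x →
      Viscosity.LipschitzNear (u i) x ∧ Viscosity.LipschitzNear (u j) x) :
    Viscosity.IsSolution (PursuitEvasion.hamiltonian d α β)
      (⋃ k : Fin m, PursuitEvasion.target k)ᶜ (fun x => ⨅ i, u i x) := by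
  have hd_cont : ∀ k, Continuous (d k) := fun k =>
    (PursuitEvasion.lipschitzWith_of_abs_le hkd.le (hd_lip k)).continuous
  have hne : Nonempty (Fin m) := ⟨⟨0, hm⟩⟩
  have hsub : ∀ i, (⋃ k : Fin m, PursuitEvasion.target k)ᶜ ⊆ (PursuitEvasion.target i)ᶜ :=
    fun i => compl_subset_compl.2 (subset_iUnion _ i)
  have hcont : ContinuousOn (fun x => ⨅ i, u i x) (⋃ k : Fin m, PursuitEvasion.target k)ᶜ := by
    simp only [← Finset.inf'_univ_eq_ciInf]
    exact ContinuousOn.finset_inf'_apply _ fun i _ => (ha i).1.1.mono (hsub i)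
  refine ⟨⟨hcont, fun x hx p hp => ?_⟩, hcont, fun x hx p hp => ?_⟩
  · have hat : ∀ i, ContinuousAt (u i) x := fun i =>
      (ha i).1.1.continuousAt ((PursuitEvasion.isOpen_compl_target i).mem_nhds (hsub i hx))
    obtain ⟨i, hi⟩ := exists_eq_ciInf_of_finite (f := fun j => u j x)
    have hle : ∀ j, u i x ≤ u j x := fun j =>
      hi.trans_le (ciInf_le (finite_range fun j => u j x).bddBelow j)
    by_cases huniq : ∀ j, j ≠ i → u i x < u j x
    · beta_reduce
      rw [← hi]
      exact (ha i).1.2 x (hsub i hx) p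
        (Viscosity.superdifferential_iInf_subset_of_forall_lt hat huniq hp)
    · push Not at huniq
      obtain ⟨j, hji, hj⟩ := huniq
      -- With at least two active indices, each active one has a distinct active partner, so the
      -- Lipschitz assumption applies to it.
      have hlip : ∀ k, u k x = ⨅ j, u j x → Viscosity.LipschitzNear (u k) x := by
        intro k hk
        by_cases hki : k = i
        · rw [hki]
          exact (hb j i hji x hx (le_antisymm hj (hle j))).2
        · exact (hb k i hki x hx (hk.trans hi.symm)).1
      have hmono : ∀ k, ∀ z ∈ (PursuitEvasion.target k)ᶜ, ∀ᶠ t in 𝓝[>] (0 : ℝ),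
          u k z ≤ u k (z + t • EuclideanSpace.single (0, 1) 1) := by
        intro k z hz
        filter_upwards [self_mem_nhdsWithin] with t ht
        have ht0 : (0 : ℝ) < t := ht
        -- Changing the evader's velocity leaves all positions, hence membership in the target,
        -- unchanged.
        have hz' : z + t • EuclideanSpace.single (0, 1) 1 ∈ (PursuitEvasion.target k)ᶜ := by
          simpa [PursuitEvasion.target] using hz
        rw [← EReal.coe_le_coe_iff, ← hu k z hz, ← hu k _ hz', EReal.coe_ennreal_le_coe_ennreal_iff]
        refine PursuitEvasion.upperValue_le_upperValue hkd hα.le hd_lip ?_ ?_ ?_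
        · rintro ⟨l, n⟩ hl
          have hl' : l ≠ 0 := hl
          simp [hl']
        · simp
        · simp [ht0.le]
      refine PursuitEvasion.hamiltonian_nonpos_of_forall_inner_neg_dynamics_le _ hα.le
        (fun i => by linarith [hβ i]) fun b hb' => ?_
      exact Viscosity.inner_le_of_mem_superdifferential_iInf hat (fun k hk c hc =>
        PursuitEvasion.eventually_sub_le_of_isSubsolution hd_cont
          (PursuitEvasion.isOpen_compl_target k) (ha k).1 (hmono k) (hsub k hx) (hlip k hk) hb' hc)
        hp
  · obtain ⟨i, hi⟩ := exists_eq_ciInf_of_finite (f := fun j => u j x)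
    beta_reduce
    rw [← hi]
    exact (ha i).2.2 x (hsub i hx) p (Viscosity.subdifferential_iInf_subset hi hp)
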